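/- Let $(X,d)$ be a complete separable metric space, let $\mathcal P(X)$ be the set of Borel probability measures on $X$, and let $W_2$ be the (possibly infinite) quadratic Wasserstein distance on $\mathcal P(X)$. Let $\mathrm{Geo}(X)$ be the space of constant speed geodesics $\gamma\colon[0,1]\to X$, that is, curves with $d(\gamma_s,\gamma_t)=|s-t|\,d(\gamma_0,\gamma_1)$ for all $s,t\in[0,1]$, with the uniform distance; let $e_t(\gamma)=\gamma_t$, and let $l(\gamma)$ be the length of $\gamma$. For $\mu_0,\mu_1\in\mathcal P(X)$ let $\mathrm{GeoOpt}(\mu_0,\mu_1)$ be the set of Borel probability measures $\pi$ on $\mathrm{Geo}(X)$ such that $t\mapsto(e_t)_\#\pi$ is a constant speed geodesic in $(\mathcal P(X),W_2)$ from $\mu_0=(e_0)_\#\pi$ to $\mu_1=(e_1)_\#\pi$, and such that the transport plan $(e_0,e_1)_\#\pi$ is optimal, i.e. minimizes $\int_{X\times X} d(x,y)^2\,d\sigma(x,y)$ among all $\sigma\in\mathcal P(X\times X)$ with marginals $\mu_0$ and $\mu_1$. **Proposition 2.5.** Let $\mu_0,\mu_1\in\mathcal P(X)$ with $W_2(\mu_0,\mu_1)<\infty$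 and let $t_0\in(0,1)$. Suppose that there exist constants $0\le C_1\le C_2<\infty$ and a measure $\pi\in\mathrm{GeoOpt}(\mu_0,\mu_1)$ with $$C_1\le l(\gamma)\le C_2\qquad\text{for }\pi\text{-a.e. }\gamma\in\mathrm{Geo}(X).$$ Then for every $\tilde\pi\in\mathrm{GeoOpt}(\mu_0,\mu_1)$ with $(e_{t_0})_\#\tilde\pi=(e_{t_0})_\#\pi$ we also have $C_1\le l(\gamma)\le C_2$ for $\tilde\pi$-a.e. $\gamma\in\mathrm{Geo}(X)$. -/

import Mathlib

open MeasureTheory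
open scoped ENNReal NNReal

noncomputable section

namespace OptimalTransport

/-- `Geo(X)`: the constant speed geodesics of `X`, parametrized by `[0,1]`. -/
def Geo (X : Type*) [MetricSpace X] : Type _ :=
  {γ : C(unitInterval, X) //
    ∀ s t : unitInterval, dist (γ s) (γ t) = |(s : ℝ) - (t : ℝ)| * dist (γ 0) (γ 1)}

/-- `Geo(X)` carries the uniform distance inherited from `C([0,1], X)`. -/
instance Geo.instMetricSpace (X : Type*) [MetricSpace X] : MetricSpace (Geo X) :=
  inferInstanceAs (MetricSpace {γ : C(unitInterval, X) //
    ∀ s t : unitInterval, dist (γ s) (γ t) = |(s : ℝ) - (t : ℝ)| * dist (γ 0) (γ 1)})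

/-- `Geo(X)` carries its Borel σ-algebra. -/
instance Geo.instMeasurableSpace (X : Type*) [MetricSpace X] : MeasurableSpace (Geo X) :=
  borel (Geo X)

instance Geo.instBorelSpace (X : Type*) [MetricSpace X] : BorelSpace (Geo X) := ⟨rfl⟩

/-- The evaluation map `e_t : Geo(X) → X`, `e_t(γ) = γ_t`. -/
def evalAt {X : Type*} [MetricSpace X] (t : unitInterval) (γ : Geo X) : X := γ.1 t

/-- The length `l(γ)` of a geodesic, as the total variation of the curve. -/
def length {X : Type*} [MetricSpace X] (γ : Geo X) : ℝ≥0∞ :=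
  eVariationOn (fun t : unitInterval => evalAt t γ) Set.univ

theorem continuous_evalAt {X : Type*} [MetricSpace X] (t : unitInterval) :
    Continuous (evalAt t : Geo X → X) := by
  have h : Continuous (fun γ : {γ : C(unitInterval, X) //
      ∀ s t : unitInterval, dist (γ s) (γ t) = |(s : ℝ) - (t : ℝ)| * dist (γ 0) (γ 1)} =>
      γ.1 t) :=
    (continuous_eval_const t).comp continuous_subtype_val
  exact h

theorem measurable_evalAt {X : Type*} [MetricSpace X] [MeasurableSpace X] [BorelSpace X]
    (t : unitInterval) : Measurable (evalAt t : Geo X → X) :=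
  (continuous_evalAt t).measurable

theorem edist_evalAt {X : Type*} [MetricSpace X] (γ : Geo X) (s t : unitInterval) :
    edist (evalAt s γ) (evalAt t γ) =
      ENNReal.ofReal |(s : ℝ) - (t : ℝ)| * edist (evalAt 0 γ) (evalAt 1 γ) := by
  rw [edist_dist, edist_dist (evalAt 0 γ), ← ENNReal.ofReal_mul (abs_nonneg _)]
  exact congrArg ENNReal.ofReal (γ.2 s t)

/-- The length of a geodesic is the distance between its endpoints. -/
theorem length_eq_edist {X : Type*} [MetricSpace X] (γ : Geo X) :
    length γ = edist (evalAt 0 γ) (evalAt 1 γ) := by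
  apply le_antisymm
  · refine iSup_le ?_
    rintro ⟨n, u, hu, -⟩
    have key : ∀ i, edist (evalAt (u (i + 1)) γ) (evalAt (u i) γ) =
        ENNReal.ofReal ((u (i + 1) : ℝ) - u i) * edist (evalAt 0 γ) (evalAt 1 γ) := by
      intro i
      have h : (u i : ℝ) ≤ u (i + 1) := hu (Nat.le_succ i)
      rw [edist_evalAt, abs_of_nonneg (sub_nonneg.2 h)]
    simp only [key]
    rw [← Finset.sum_mul, ← ENNReal.ofReal_sum_of_nonneg
      (fun i _ => sub_nonneg.2 (show (u i : ℝ) ≤ u (i + 1) from hu (Nat.le_succ i))),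
      Finset.sum_range_sub (fun i => (u i : ℝ))]
    have h1 : ENNReal.ofReal ((u n : ℝ) - u 0) ≤ 1 := by
      rw [ENNReal.ofReal_le_one]
      linarith [(u n).2.2, (u 0).2.1]
    calc _ ≤ 1 * edist (evalAt 0 γ) (evalAt 1 γ) := by gcongr
      _ = _ := one_mul _
  · exact eVariationOn.edist_le (fun t : unitInterval => evalAt t γ)
      (Set.mem_univ 0) (Set.mem_univ 1)

/-- The couplings of `μ` and `ν`: the `σ ∈ 𝒫(X × X)` with first marginal `μ` and second
marginal `ν`. -/
def couplings {X : Type*} [MeasurableSpace X] (μ ν : ProbabilityMeasure X) :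
    Set (ProbabilityMeasure (X × X)) :=
  {σ | σ.map measurable_fst.aemeasurable = μ ∧ σ.map measurable_snd.aemeasurable = ν}

/-- The quadratic cost `∫ d(x,y)² dσ(x,y)`. -/
def cost {X : Type*} [MetricSpace X] [MeasurableSpace X] (σ : ProbabilityMeasure (X × X)) :
    ℝ≥0∞ :=
  ∫⁻ p, edist p.1 p.2 ^ 2 ∂(σ : Measure (X × X))

/-- The (possibly infinite) Wasserstein distance `W₂`. -/
def W₂ {X : Type*} [MetricSpace X] [MeasurableSpace X] (μ ν : ProbabilityMeasure X) : ℝ≥0∞ :=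
  (⨅ σ ∈ couplings μ ν, cost σ) ^ (1 / 2 : ℝ)

/-- `σ` is an optimal coupling of `μ` and `ν`. -/
def IsOptimalCoupling {X : Type*} [MetricSpace X] [MeasurableSpace X]
    (μ ν : ProbabilityMeasure X) (σ : ProbabilityMeasure (X × X)) : Prop :=
  σ ∈ couplings μ ν ∧ ∀ σ' ∈ couplings μ ν, cost σ ≤ cost σ'

/-- A constant speed geodesic in `(𝒫(X), W₂)`, parametrized by `[0,1]`. -/
def IsWassersteinGeodesic {X : Type*} [MetricSpace X] [MeasurableSpace X]
    (μ : unitInterval → ProbabilityMeasure X) : Prop :=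
  ∀ s t : unitInterval, W₂ (μ s) (μ t) = ENNReal.ofReal |(s : ℝ) - (t : ℝ)| * W₂ (μ 0) (μ 1)

/-- The push-forward `(e_t)_# π`. -/
def marginalAt {X : Type*} [MetricSpace X] [MeasurableSpace X] [BorelSpace X]
    (π : ProbabilityMeasure (Geo X)) (t : unitInterval) : ProbabilityMeasure X :=
  π.map (measurable_evalAt t).aemeasurable

/-- The push-forward `(e_0, e_1)_# π`, the transport plan induced by `π`. -/
def endpointPlan {X : Type*} [MetricSpace X] [MeasurableSpace X] [BorelSpace X]
    (π : ProbabilityMeasure (Geo X)) : ProbabilityMeasure (X × X) :=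
  π.map ((measurable_evalAt 0).prodMk (measurable_evalAt 1)).aemeasurable

/-- `GeoOpt(μ₀, μ₁)`: the optimal dynamical plans from `μ₀` to `μ₁`, i.e. the `π ∈ 𝒫(Geo(X))`
such that `t ↦ (e_t)_# π` is a geodesic in `(𝒫(X), W₂)` from `μ₀ = (e_0)_# π` to
`μ₁ = (e_1)_# π`, and the transport plan `(e_0, e_1)_# π` induced by `π` is optimal. -/
def GeoOpt {X : Type*} [MetricSpace X] [MeasurableSpace X] [BorelSpace X]
    (μ₀ μ₁ : ProbabilityMeasure X) : Set (ProbabilityMeasure (Geo X)) :=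
  {π | marginalAt π 0 = μ₀ ∧ marginalAt π 1 = μ₁ ∧ IsWassersteinGeodesic (marginalAt π) ∧
    IsOptimalCoupling μ₀ μ₁ (endpointPlan π)}

end OptimalTransport

end

/-!
The two optimal dynamical plans are compared by crossing them at time `t₀`. Since their marginals at
`t₀` agree, they can be glued there: there is a law on triples `(x, (p, q))` in which `p` and `q` are
the endpoint pairs of a `π`-random and a `π'`-random geodesic, both passing through the same point `x`
at time `t₀` (`exists_gluing`, by disintegration). With `A` and `B` the lengths of the two geodesics,
following the first one up to `t₀` and the second one afterwards joins `p.1` to `q.2` by a path of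
length `t₀ A + (1 - t₀) B`, so that
`d(p.1, q.2)² + t₀ (1 - t₀) (A - B)² ≤ t₀ A² + (1 - t₀) B²`
(`edist_sq_add_le_of_crossing`). The law of `(p.1, q.2)` is again a coupling of `μ₀` and `μ₁`, hence
costs at least as much as the optimal plans, whose finite common cost is the integral of the right-hand
side. Therefore `A = B` almost surely, and any almost sure bound on the length passes from `π` to `π'`.
-/

open MeasureTheory ProbabilityTheory
open scoped ENNReal NNReal

namespace OptimalTransport

/-- Two finite measures with the same first marginal are the `(x, y)`- and `(x, z)`-marginals of a
common measure: take `y` and `z` conditionally independent given `x`. -/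
theorem exists_gluing {S Y Z : Type*} [MeasurableSpace S]
    [MeasurableSpace Y] [StandardBorelSpace Y] [Nonempty Y]
    [MeasurableSpace Z] [StandardBorelSpace Z] [Nonempty Z]
    (ρ : Measure (S × Y)) (ρ' : Measure (S × Z)) [IsFiniteMeasure ρ] [IsFiniteMeasure ρ']
    (h : ρ.fst = ρ'.fst) :
    ∃ Θ : Measure (S × (Y × Z)),
      Θ.map (Prod.map id Prod.fst) = ρ ∧ Θ.map (Prod.map id Prod.snd) = ρ' := by
  refine ⟨ρ.fst ⊗ₘ (ρ.condKernel ×ₖ ρ'.condKernel), ?_, ?_⟩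
  · rw [← Measure.compProd_map measurable_fst, ← Kernel.fst_eq, Kernel.fst_prod,
      ρ.disintegrate]
  · rw [← Measure.compProd_map measurable_snd, ← Kernel.snd_eq, Kernel.snd_prod, h,
      ρ'.disintegrate]

/-- The path from `p.1` to `q.2` through a common intermediate point at proportion `t` is shorter than
convexity of the square alone predicts, by a multiple of the squared difference of lengths. -/
theorem edist_sq_add_le_of_crossing {X : Type*} [MetricSpace X] {t : ℝ} (ht₀ : 0 ≤ t) (ht₁ : t ≤ 1)
    {x : X} {p q : X × X} (hp : dist p.1 x = t * dist p.1 p.2)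
    (hq : dist x q.2 = (1 - t) * dist q.1 q.2) :
    edist p.1 q.2 ^ 2 + ENNReal.ofReal (t * (1 - t) * (dist p.1 p.2 - dist q.1 q.2) ^ 2) ≤
      ENNReal.ofReal t * edist p.1 p.2 ^ 2 + ENNReal.ofReal (1 - t) * edist q.1 q.2 ^ 2 := by
  have ht₂ : 0 ≤ 1 - t := sub_nonneg.2 ht₁
  have htri : dist p.1 q.2 ≤ t * dist p.1 p.2 + (1 - t) * dist q.1 q.2 :=
    (dist_triangle _ x _).trans_eq (by rw [hp, hq])
  have hsq := pow_le_pow_left₀ dist_nonneg htri 2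
  simp only [edist_dist, ← ENNReal.ofReal_pow dist_nonneg]
  rw [← ENNReal.ofReal_mul ht₀, ← ENNReal.ofReal_mul ht₂,
    ← ENNReal.ofReal_add (by positivity) (by positivity),
    ← ENNReal.ofReal_add (by positivity) (by positivity)]
  apply ENNReal.ofReal_le_ofReal
  linear_combination hsq

/-- The joint law of `γ_t` and the endpoints `(γ_0, γ_1)` under a dynamical plan. -/
noncomputable def crossingLaw {X : Type*} [MetricSpace X] [MeasurableSpace X]
    (π : ProbabilityMeasure (Geo X)) (t : unitInterval) : Measure (X × (X × X)) :=
  (π : Measure (Geo X)).map fun γ => (evalAt t γ, (evalAt 0 γ, evalAt 1 γ))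

section

variable {X : Type*} [MetricSpace X] [MeasurableSpace X] [BorelSpace X]

theorem measurable_crossing (t : unitInterval) :
    Measurable fun γ : Geo X => (evalAt t γ, (evalAt 0 γ, evalAt 1 γ)) :=
  (measurable_evalAt t).prodMk ((measurable_evalAt 0).prodMk (measurable_evalAt 1))

theorem isProbabilityMeasure_crossingLaw (π : ProbabilityMeasure (Geo X)) (t : unitInterval) :
    IsProbabilityMeasure (crossingLaw π t) :=
  Measure.isProbabilityMeasure_map (measurable_crossing t).aemeasurable

theorem map_crossingLaw {Z : Type*} [MeasurableSpace Z] (π : ProbabilityMeasure (Geo X))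
    (t : unitInterval) {f : X × (X × X) → Z} (hf : Measurable f) :
    (crossingLaw π t).map f =
      (π : Measure (Geo X)).map fun γ => f (evalAt t γ, (evalAt 0 γ, evalAt 1 γ)) :=
  Measure.map_map hf (measurable_crossing t)

theorem fst_crossingLaw (π : ProbabilityMeasure (Geo X)) (t : unitInterval) :
    (crossingLaw π t).fst = (marginalAt π t : Measure X) :=
  map_crossingLaw π t measurable_fst

theorem lintegral_crossingLaw [SecondCountableTopology X] (π : ProbabilityMeasure (Geo X))
    (t : unitInterval) :
    ∫⁻ w, edist w.2.1 w.2.2 ^ 2 ∂crossingLaw π t = cost (endpointPlan π) := by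
  have h : (endpointPlan π : Measure (X × X)) = (crossingLaw π t).map Prod.snd :=
    (map_crossingLaw π t measurable_snd).symm
  rw [cost, h, lintegral_map (by fun_prop) measurable_snd]

theorem ae_crossingLaw_dist [SecondCountableTopology X] (π : ProbabilityMeasure (Geo X))
    (t : unitInterval) :
    ∀ᵐ w ∂crossingLaw π t, dist w.2.1 w.1 = t * dist w.2.1 w.2.2 ∧
      dist w.1 w.2.2 = (1 - t) * dist w.2.1 w.2.2 := by
  have hm : MeasurableSet {w : X × (X × X) | dist w.2.1 w.1 = t * dist w.2.1 w.2.2 ∧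
      dist w.1 w.2.2 = (1 - t) * dist w.2.1 w.2.2} :=
    (measurableSet_eq_fun (by fun_prop) (by fun_prop)).inter
      (measurableSet_eq_fun (by fun_prop) (by fun_prop))
  rw [crossingLaw, ae_map_iff (measurable_crossing t).aemeasurable hm]
  refine .of_forall fun γ => ⟨?_, ?_⟩
  · have h := γ.2 0 t
    rwa [Set.Icc.coe_zero, zero_sub, abs_neg, abs_of_nonneg t.2.1] at h
  · have h := γ.2 t 1
    rwa [Set.Icc.coe_one, abs_sub_comm, abs_of_nonneg (sub_nonneg.2 t.2.2)] at h

theorem measurableSet_edist_mem_Icc [SecondCountableTopology X] (C₁ C₂ : ℝ≥0∞) :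
    MeasurableSet {w : X × (X × X) | C₁ ≤ edist w.2.1 w.2.2 ∧ edist w.2.1 w.2.2 ≤ C₂} := by
  have h : Measurable fun w : X × (X × X) => edist w.2.1 w.2.2 := by fun_prop
  exact h measurableSet_Icc

theorem ae_length_iff [SecondCountableTopology X] (π : ProbabilityMeasure (Geo X))
    (t : unitInterval) (C₁ C₂ : ℝ≥0∞) :
    (∀ᵐ γ ∂(π : Measure (Geo X)), C₁ ≤ length γ ∧ length γ ≤ C₂) ↔
      ∀ᵐ w ∂crossingLaw π t, C₁ ≤ edist w.2.1 w.2.2 ∧ edist w.2.1 w.2.2 ≤ C₂ := by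
  rw [crossingLaw, ae_map_iff (measurable_crossing t).aemeasurable
    (measurableSet_edist_mem_Icc C₁ C₂)]
  simp only [length_eq_edist]

theorem cost_endpointPlan_lt_top {μ₀ μ₁ : ProbabilityMeasure X} (hW : W₂ μ₀ μ₁ < ∞)
    {π : ProbabilityMeasure (Geo X)} (hπ : π ∈ GeoOpt μ₀ μ₁) : cost (endpointPlan π) < ∞ := by
  refine (le_iInf₂ hπ.2.2.2.2).trans_lt ?_
  rwa [W₂, ENNReal.rpow_lt_top_iff_of_pos (by norm_num)] at hW

end

/-- Gluing two optimal dynamical plans at an intermediate time at which their marginals agree pairs up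
geodesics of equal length. -/
theorem exists_gluing_dist_eq {X : Type*} [MetricSpace X] [CompleteSpace X]
    [SecondCountableTopology X] [MeasurableSpace X] [BorelSpace X]
    {μ₀ μ₁ : ProbabilityMeasure X} (hW : W₂ μ₀ μ₁ < ∞)
    {t : unitInterval} (ht₀ : 0 < t) (ht₁ : t < 1) {π π' : ProbabilityMeasure (Geo X)}
    (hπ : π ∈ GeoOpt μ₀ μ₁) (hπ' : π' ∈ GeoOpt μ₀ μ₁) (h : marginalAt π t = marginalAt π' t) :
    ∃ Θ : Measure (X × ((X × X) × (X × X))),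
      Θ.map (Prod.map id Prod.fst) = crossingLaw π t ∧
      Θ.map (Prod.map id Prod.snd) = crossingLaw π' t ∧
      ∀ᵐ w ∂Θ, dist w.2.1.1 w.2.1.2 = dist w.2.2.1 w.2.2.2 := by
  have := isProbabilityMeasure_crossingLaw π t
  have := isProbabilityMeasure_crossingLaw π' t
  have : Nonempty X := μ₀.nonempty
  obtain ⟨Θ, h₁, h₂⟩ := exists_gluing (crossingLaw π t) (crossingLaw π' t)
    (by rw [fst_crossingLaw, fst_crossingLaw, h])
  refine ⟨Θ, h₁, h₂, ?_⟩
  have m₁ : Measurable (Prod.map id Prod.fst : X × ((X × X) × (X × X)) → X × (X × X)) := by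
    fun_prop
  have m₂ : Measurable (Prod.map id Prod.snd : X × ((X × X) × (X × X)) → X × (X × X)) := by
    fun_prop
  have hΘ : IsProbabilityMeasure Θ := by
    rw [← Measure.isProbabilityMeasure_map_iff m₁.aemeasurable, h₁]
    infer_instance
  have ht₀' : (0 : ℝ) < t := ht₀
  have ht₁' : (0 : ℝ) < 1 - t := sub_pos.2 ht₁
  have mσ : Measurable fun w : X × ((X × X) × (X × X)) => (w.2.1.1, w.2.2.2) := by fun_prop
  -- The crossed endpoints, from the first geodesic at time `0` and the second at time `1`.
  let σ : ProbabilityMeasure (X × X) :=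
    ProbabilityMeasure.map ⟨Θ, hΘ⟩ mσ.aemeasurable
  have hσ : (σ : Measure (X × X)) = Θ.map fun w => (w.2.1.1, w.2.2.2) := rfl
  have hσmem : σ ∈ couplings μ₀ μ₁ := by
    constructor
    · rw [← hπ.1]
      apply Subtype.ext
      change Measure.map Prod.fst (Θ.map fun w => (w.2.1.1, w.2.2.2)) = _
      rw [Measure.map_map measurable_fst mσ]
      exact ((Measure.map_map (measurable_fst.comp measurable_snd) m₁).symm.trans
        (congrArg _ h₁)).trans (map_crossingLaw π t (measurable_fst.comp measurable_snd))
    · rw [← hπ'.2.1]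
      apply Subtype.ext
      change Measure.map Prod.snd (Θ.map fun w => (w.2.1.1, w.2.2.2)) = _
      rw [Measure.map_map measurable_snd mσ]
      exact ((Measure.map_map (measurable_snd.comp measurable_snd) m₂).symm.trans
        (congrArg _ h₂)).trans (map_crossingLaw π' t (measurable_snd.comp measurable_snd))
  have hσcost : cost σ = ∫⁻ w, edist w.2.1.1 w.2.2.2 ^ 2 ∂Θ := by
    rw [cost, hσ, lintegral_map (by fun_prop) mσ]
  have hA : ∫⁻ w, edist w.2.1.1 w.2.1.2 ^ 2 ∂Θ = cost (endpointPlan π) := by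
    rw [← lintegral_crossingLaw π t, ← h₁, lintegral_map (by fun_prop) m₁]
    rfl
  have hB : ∫⁻ w, edist w.2.2.1 w.2.2.2 ^ 2 ∂Θ = cost (endpointPlan π') := by
    rw [← lintegral_crossingLaw π' t, ← h₂, lintegral_map (by fun_prop) m₂]
    rfl
  have hd₁ := ae_of_ae_map m₁.aemeasurable (h₁ ▸ ae_crossingLaw_dist π t)
  have hd₂ := ae_of_ae_map m₂.aemeasurable (h₂ ▸ ae_crossingLaw_dist π' t)
  have mD : Measurable fun w : X × ((X × X) × (X × X)) => ENNReal.ofReal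
      ((t : ℝ) * (1 - t) * (dist w.2.1.1 w.2.1.2 - dist w.2.2.1 w.2.2.2) ^ 2) := by fun_prop
  have hsum : cost (endpointPlan π) + ∫⁻ w, ENNReal.ofReal
      ((t : ℝ) * (1 - t) * (dist w.2.1.1 w.2.1.2 - dist w.2.2.1 w.2.2.2) ^ 2) ∂Θ ≤
      cost (endpointPlan π) := calc
    _ ≤ cost σ + ∫⁻ w, ENNReal.ofReal
        ((t : ℝ) * (1 - t) * (dist w.2.1.1 w.2.1.2 - dist w.2.2.1 w.2.2.2) ^ 2) ∂Θ := by
      gcongr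
      exact hπ.2.2.2.2 σ hσmem
    _ = ∫⁻ w, (edist w.2.1.1 w.2.2.2 ^ 2 + ENNReal.ofReal
        ((t : ℝ) * (1 - t) * (dist w.2.1.1 w.2.1.2 - dist w.2.2.1 w.2.2.2) ^ 2)) ∂Θ := by
      rw [lintegral_add_right _ mD, hσcost]
    _ ≤ ∫⁻ w, (ENNReal.ofReal t * edist w.2.1.1 w.2.1.2 ^ 2 +
        ENNReal.ofReal (1 - t) * edist w.2.2.1 w.2.2.2 ^ 2) ∂Θ := by
      apply lintegral_mono_ae
      filter_upwards [hd₁, hd₂] with w hw₁ hw₂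
      exact edist_sq_add_le_of_crossing ht₀'.le t.2.2 hw₁.1 hw₂.2
    _ = ENNReal.ofReal t * cost (endpointPlan π) +
        ENNReal.ofReal (1 - t) * cost (endpointPlan π') := by
      rw [lintegral_add_left (by fun_prop), lintegral_const_mul _ (by fun_prop),
        lintegral_const_mul _ (by fun_prop), hA, hB]
    _ ≤ ENNReal.ofReal t * cost (endpointPlan π) +
        ENNReal.ofReal (1 - t) * cost (endpointPlan π) := by
      gcongr
      exact hπ'.2.2.2.2 _ hπ.2.2.2.1
    _ = cost (endpointPlan π) := by
      rw [← add_mul, ← ENNReal.ofReal_add ht₀'.le ht₁'.le, add_sub_cancel, ENNReal.ofReal_one,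
        one_mul]
  have hzero := (ENNReal.add_le_add_iff_left (cost_endpointPlan_lt_top hW hπ).ne).1
    (hsum.trans_eq (add_zero _).symm)
  filter_upwards [(lintegral_eq_zero_iff mD).1 (nonpos_iff_eq_zero.1 hzero)] with w hw
  have hw' := ENNReal.ofReal_eq_zero.1 hw
  exact sub_eq_zero.1 (pow_eq_zero_iff two_ne_zero |>.1
    (le_antisymm (nonpos_of_mul_nonpos_right hw' (mul_pos ht₀' ht₁')) (sq_nonneg _)))

end OptimalTransport

theorem proposition2p5 {X : Type*} [MetricSpace X] [CompleteSpace X]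
    [TopologicalSpace.SeparableSpace X] [MeasurableSpace X] [BorelSpace X]
    (μ₀ μ₁ : ProbabilityMeasure X) (hW : OptimalTransport.W₂ μ₀ μ₁ < ∞)
    (t₀ : unitInterval) (ht₀ : 0 < t₀) (ht₁ : t₀ < 1)
    (C₁ C₂ : ℝ≥0) (hC : C₁ ≤ C₂)
    (π : ProbabilityMeasure (OptimalTransport.Geo X))
    (hπ : π ∈ OptimalTransport.GeoOpt μ₀ μ₁)
    (hlen : ∀ᵐ γ ∂(π : Measure (OptimalTransport.Geo X)),
      (C₁ : ℝ≥0∞) ≤ OptimalTransport.length γ ∧ OptimalTransport.length γ ≤ (C₂ : ℝ≥0∞))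
    (π' : ProbabilityMeasure (OptimalTransport.Geo X))
    (hπ' : π' ∈ OptimalTransport.GeoOpt μ₀ μ₁)
    (hmarg : OptimalTransport.marginalAt π' t₀ = OptimalTransport.marginalAt π t₀) :
    ∀ᵐ γ ∂(π' : Measure (OptimalTransport.Geo X)),
      (C₁ : ℝ≥0∞) ≤ OptimalTransport.length γ ∧ OptimalTransport.length γ ≤ (C₂ : ℝ≥0∞) := by
  have := UniformSpace.secondCountable_of_separable X
  obtain ⟨Θ, h₁, h₂, hΘ⟩ :=
    OptimalTransport.exists_gluing_dist_eq hW ht₀ ht₁ hπ hπ' hmarg.symm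
  rw [OptimalTransport.ae_length_iff π t₀, ← h₁] at hlen
  rw [OptimalTransport.ae_length_iff π' t₀, ← h₂, ae_map_iff (by fun_prop)
    (OptimalTransport.measurableSet_edist_mem_Icc _ _)]
  filter_upwards [ae_of_ae_map (by fun_prop) hlen, hΘ] with w hw heq
  simpa only [Prod.map_fst, Prod.map_snd, id, edist_dist, heq] using hw
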